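/- **Setting.** Fix constants $k,d\in\mathbb N$. An instance of MST verification on $n\ge 1$ nodes consists of a connected simple graph $G=(V,E)$ with $|V|=n$, pairwise distinct node identifiers $\mathrm{ID}(v)\in\{0,\dots,n^k\}$, integer edge weights $w:E\to\mathbb Z$ with $|w(e)|\le n^d$, and an arbitrary set $T\subseteq E$ of marked edges. The input $I(v)$ of a node $v$ lists, for each edge $e=\{v,u\}$ incident to $v$, the identifier of $u$, the weight $w(e)$, and whether $e\in T$. The instance is a *yes-instance* if $(V,T)$ is a spanning tree of $G$ whose total weight $\sum_{e\in T}w(e)$ is minimum among all spanning trees of $G$. For a function $t:\mathbb N\to\mathbb N$, a *$t$-PLS* (proof labeling scheme of radius $t$) for MST verification is a pair $(\mathrm{Prov},\mathrm{Ver})$. The prover $\mathrm{Prov}$ maps each yes-instance to a labeling $\ell:V\to\{0,1\}^*$. The verifier $\mathrm{Ver}$ is a function that, for a node $v$ of an $n$-node instance with a labeling $\ell$, receives $n$, $\mathrm{ID}(v)$, the subgraph of $G$ induced by the ball $B_{t(n)}(v)=\{u:\mathrm{dist}_G(u,v)\le t(n)\}$ with its identifiers, and $I(u),\ell(u)$ for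 all $u\in B_{t(n)}(v)$, and outputs accept or reject. It is required that - (completeness) on every yes-instance, with the labeling given by $\mathrm{Prov}$, all nodes accept; - (soundness) for every instance and every labeling $\ell:V\to\{0,1\}^*$, if all nodes accept, then the instance is a yes-instance. Its *cost* at $n$ is the maximum length of a label given by $\mathrm{Prov}$ to a node, over all $n$-node yes-instances. **Corollary ($t$-PLS for MST verification).** For all $k,d\in\mathbb N$ there is a constant $C=C(k,d)$ such that for every $t:\mathbb N\to\mathbb N$ with $t(n)\ge 1$ and $t(n)\ge\log_2 n$ for all $n\ge 1$, there is a $t$-PLS for MST verification whose cost at $n$ is at most $C\cdot\lceil \log_2^3 n/t(n)\rceil$ for every $n\ge 1$. -/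

import Mathlib

namespace ProofLabeling

/-- A configuration on `n` nodes: a connected graph on `Fin n`, pairwise distinct node identifiers
in `{0, …, n ^ k}` (i.e. of `O(log n)` bits), and an input at every node. -/
structure Config (Input : Type) (k n : ℕ) where
  graph : SimpleGraph (Fin n)
  connected : graph.Connected
  id : Fin n → ℕ
  id_injective : Function.Injective id
  id_le : ∀ v, id v ≤ n ^ k
  input : Fin n → Input

/-- What a node sees: the number of nodes of the whole graph, its own identifier, the triples
(identifier, input, label) of the nodes in its neighborhood, and the edges of its neighborhood
(as pairs of identifiers). -/
structure View (Input : Type) where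
  size : ℕ
  center : ℕ
  nodes : Set (ℕ × Input × List Bool)
  edges : Set (Sym2 ℕ)

/-- The ball of radius `t` around `v` in the shortest path metric. -/
def Config.ball {Input : Type} {k n : ℕ} (c : Config Input k n) (t : ℕ) (v : Fin n) :
    Set (Fin n) :=
  {u | c.graph.dist v u ≤ t}

/-- The `t`-hop view of the node `v` under the labeling `l`. -/
def Config.view {Input : Type} {k n : ℕ} (c : Config Input k n) (l : Fin n → List Bool)
    (t : ℕ) (v : Fin n) : View Input where
  size := n
  center := c.id v
  nodes := {x | ∃ u ∈ c.ball t v, x = (c.id u, c.input u, l u)}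
  edges := {e | ∃ u ∈ c.ball t v, ∃ w ∈ c.ball t v, c.graph.Adj u w ∧ e = s(c.id u, c.id w)}

/-- A proof labeling scheme with radius `t n` on `n`-node graphs, for the predicate `P` on the
configuration family `F`. The values of `prov` outside `P` are irrelevant. -/
structure PLS {Input : Type} {k : ℕ} (F P : ∀ n, Set (Config Input k n)) (t : ℕ → ℕ) where
  prov : ∀ {n : ℕ}, Config Input k n → Fin n → List Bool
  ver : View Input → Bool
  complete : ∀ {n : ℕ}, ∀ c ∈ P n, ∀ v, ver (c.view (prov c) (t n) v) = true
  sound : ∀ {n : ℕ}, ∀ c ∈ F n, ∀ l : Fin n → List Bool,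
    (∀ v, ver (c.view l (t n) v) = true) → c ∈ P n

/-- The maximal length of a label that the prover assigns on an `n`-node configuration
satisfying the predicate. -/
noncomputable def PLS.cost {Input : Type} {k : ℕ} {F P : ∀ n, Set (Config Input k n)} {t : ℕ → ℕ}
    (S : PLS F P t) (n : ℕ) : ℕ∞ :=
  ⨆ c ∈ P n, ⨆ v : Fin n, ((S.prov c v).length : ℕ∞)

/-- The total weight of the edges of `H`. -/
noncomputable def totalWeight {n : ℕ} (w : Sym2 (Fin n) → ℤ) (H : SimpleGraph (Fin n)) : ℤ :=
  open Classical in ∑ e ∈ H.edgeFinset, w e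

/-- `T` is a spanning tree of `G`. -/
def IsSpanningTree {n : ℕ} (G T : SimpleGraph (Fin n)) : Prop :=
  T ≤ G ∧ T.IsTree

/-- `T` is a spanning tree of `G` of minimum total weight with respect to `w`. -/
def IsMST {n : ℕ} (G : SimpleGraph (Fin n)) (w : Sym2 (Fin n) → ℤ) (T : SimpleGraph (Fin n)) :
    Prop :=
  IsSpanningTree G T ∧ ∀ T', IsSpanningTree G T' → totalWeight w T ≤ totalWeight w T'

/-- The input of a node in MST verification: for each incident edge, the identifier of the other
endpoint, the weight of the edge, and a bit telling whether the edge is marked. -/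
abbrev MSTInput : Type := Finset (ℕ × ℤ × Bool)

/-- The input of the node `u` that encodes the edge weights `w` and the set of marked edges
(the edges of `T`). -/
noncomputable def mstInput {n : ℕ} (G : SimpleGraph (Fin n)) (id : Fin n → ℕ)
    (w : Sym2 (Fin n) → ℤ) (T : SimpleGraph (Fin n)) (u : Fin n) : MSTInput :=
  open Classical in
  (G.neighborFinset u).image fun v => (id v, w s(u, v), decide (T.Adj u v))

/-- The inputs of `c` encode integer edge weights `w` with `|w e| ≤ n ^ d` on the edges of the
graph, together with the marked subgraph `T`. -/
def Encodes (d : ℕ) {k n : ℕ} (c : Config MSTInput k n) (w : Sym2 (Fin n) → ℤ)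
    (T : SimpleGraph (Fin n)) : Prop :=
  (∀ e ∈ c.graph.edgeSet, |w e| ≤ (n : ℤ) ^ d) ∧ T ≤ c.graph ∧
    ∀ u, c.input u = mstInput c.graph c.id w T u

/-- All configurations of MST verification: a weighted graph with an arbitrary marked subgraph. -/
def mstFamily (k d n : ℕ) : Set (Config MSTInput k n) :=
  {c | ∃ w T, Encodes d c w T}

/-- The MST predicate: the marked edges form a minimum spanning tree. (The encoding determines `T`
and the weights of all edges of the graph.) -/
def mstPredicate (k d n : ℕ) : Set (Config MSTInput k n) :=
  {c | ∃ w T, Encodes d c w T ∧ IsMST c.graph w T}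

end ProofLabeling

/-! A spanning tree T is minimum iff the ends of every graph edge of weight β are joined in T by
edges of weight at most β (`IsMST.reachable_below`, `isMST_of_reachable_below`). So it suffices to
certify that T is a tree and, for each β, to certify connections inside the components of the edges
of T of weight at most β, the fragments.

Only portals carry certificates: nodes at depth divisible by s with a descendant s - 1 levels below,
where s is about t/5. Every tree path of length 4(s - 1) meets a portal
(`Rooting.exists_portal_of_isPath`), and each portal spreads its certificate over a vertical path of
s nodes; these paths are disjoint. The certificate holds the depth and, for every weight level, the
identifier of a representative portal of the fragment and the tree distance to it. There are 2n^d +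
1 levels, but when fragments merge, the part with the most portals keeps its representative, so a
portal sees at most log n changes (`exists_representatives_few_changes`). Recording only the changes
takes O(log² n) bits, shared by s nodes.

For soundness, strictly decreasing distances force every portal to be connected inside its fragment
to the node it names, so equal names join the ends of an edge. Decreasing depths produce a root, and
colors modulo 3 orient the marked edges with at most one parent per node, which leaves at most n - 1
edges in a connected graph. -/

namespace ProofLabeling

open SimpleGraph

/-! ### Exchange of tree edges and the threshold criterion for minimality -/

/-- The subgraph of `T` formed by the edges of weight at most `b`. -/
def below {n : ℕ} (T : SimpleGraph (Fin n)) (w : Sym2 (Fin n) → ℤ) (b : ℤ) :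
    SimpleGraph (Fin n) where
  Adj x y := T.Adj x y ∧ w s(x, y) ≤ b
  symm := ⟨fun x y h => ⟨h.1.symm, by rw [Sym2.eq_swap]; exact h.2⟩⟩
  loopless := ⟨fun x h => T.loopless.irrefl x h.1⟩

theorem below_le {n : ℕ} (T : SimpleGraph (Fin n)) (w : Sym2 (Fin n) → ℤ) (b : ℤ) :
    below T w b ≤ T := fun _ _ h => h.1

theorem below_mono {n : ℕ} (T : SimpleGraph (Fin n)) (w : Sym2 (Fin n) → ℤ) {a b : ℤ}
    (h : a ≤ b) : below T w a ≤ below T w b := fun _ _ hx => ⟨hx.1, hx.2.trans h⟩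

theorem totalWeight_eq_sum_filter {n : ℕ} (w : Sym2 (Fin n) → ℤ) (H : SimpleGraph (Fin n))
    [DecidablePred fun e => e ∈ H.edgeSet] : totalWeight w H = ∑ e with e ∈ H.edgeSet, w e := by
  classical
  unfold totalWeight
  apply Finset.sum_congr _ (fun _ _ => rfl)
  ext e
  simp

/-- Deleting an edge of a tree and reconnecting the two parts gives a tree. -/
theorem isTree_exchange {V : Type*} {T : SimpleGraph V} (hT : T.IsTree) {a b x y : V}
    (hxy : ¬ (T.deleteEdges {s(a, b)}).Reachable x y) :
    (T.deleteEdges {s(a, b)} ⊔ edge x y).IsTree := by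
  set H := T.deleteEdges {s(a, b)} with hH
  have side : ∀ z, H.Reachable a z ∨ H.Reachable b z := by
    intro z
    obtain ⟨p⟩ := hT.connected a z
    induction p using Walk.concatRec with
    | Hnil => exact Or.inl (Reachable.refl _)
    | Hconcat p h ih =>
      rename_i u v w
      -- A step along the deleted edge ends at one of the two endpoints of that edge; any other step
      -- survives the deletion.
      by_cases he : s(v, w) = s(u, b)
      · rcases Sym2.eq_iff.1 he with ⟨-, rfl⟩ | ⟨-, rfl⟩
        · exact Or.inr (Reachable.refl _)
        · exact Or.inl (Reachable.refl _)
      · have hadj : H.Adj v w := by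
          rw [hH, deleteEdges_adj]
          exact ⟨h, by simpa using he⟩
        exact (ih hxy hH).imp (fun q => q.trans hadj.reachable) (fun q => q.trans hadj.reachable)
  have hne : x ≠ y := fun h => hxy (h ▸ Reachable.refl _)
  have hle : H ≤ H ⊔ edge x y := le_sup_left
  have hadj : (H ⊔ edge x y).Adj x y := by
    simp [edge_adj, hne]
  have hab : (H ⊔ edge x y).Reachable a b := by
    rcases side x with hx | hx <;> rcases side y with hy | hy
    · exact absurd (hx.symm.trans hy) hxy
    · exact ((hx.mono hle).trans hadj.reachable).trans (hy.mono hle).symm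
    · exact ((hy.mono hle).trans hadj.reachable.symm).trans (hx.mono hle).symm
    · exact absurd (hx.symm.trans hy) hxy
  have all : ∀ z, (H ⊔ edge x y).Reachable a z := fun z =>
    (side z).elim (fun h => h.mono hle) (fun h => hab.trans (h.mono hle))
  have : Nonempty V := ⟨a⟩
  refine ⟨⟨fun u v => (all u).symm.trans (all v)⟩, ?_⟩
  exact (hT.isAcyclic.anti (deleteEdges_le _)).sup_edge_of_not_reachable hxy

theorem totalWeight_exchange {n : ℕ} (w : Sym2 (Fin n) → ℤ) {T : SimpleGraph (Fin n)}
    {a b x y : Fin n} (hab : T.Adj a b) (hxy : ¬ (T.deleteEdges {s(a, b)}).Reachable x y) :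
    totalWeight w (T.deleteEdges {s(a, b)} ⊔ edge x y) + w s(a, b) =
      totalWeight w T + w s(x, y) := by
  classical
  have hne : x ≠ y := fun h => hxy (h ▸ Reachable.refl _)
  have hnot : s(x, y) ∉ (T.deleteEdges {s(a, b)}).edgeSet := fun h => hxy (Adj.reachable h)
  rw [totalWeight_eq_sum_filter, totalWeight_eq_sum_filter]
  have h1 : (Finset.univ.filter fun e => e ∈ (T.deleteEdges {s(a, b)} ⊔ edge x y).edgeSet) =
      insert s(x, y) ((Finset.univ.filter fun e => e ∈ T.edgeSet).erase s(a, b)) := by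
    ext e
    simp [edgeSet_edge_of_ne hne, edgeSet_sup]
    tauto
  have h2 : s(x, y) ∉ (Finset.univ.filter fun e => e ∈ T.edgeSet).erase s(a, b) := by
    simp only [Finset.mem_erase, Finset.mem_filter, Finset.mem_univ, true_and]
    intro h
    exact hnot (by rw [edgeSet_deleteEdges]; exact ⟨h.2, by simpa using h.1⟩)
  rw [h1, Finset.sum_insert h2]
  have := Finset.sum_erase_add (Finset.univ.filter fun e => e ∈ T.edgeSet) w
    (a := s(a, b)) (by simpa using hab)
  linarith

/-- Otherwise the tree path from `x` to `y` has an edge heavier than `s(x, y)`, and swapping the two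
gives a lighter spanning tree. -/
theorem IsMST.reachable_below {n : ℕ} {G T : SimpleGraph (Fin n)} {w : Sym2 (Fin n) → ℤ}
    (h : IsMST G w T) {x y : Fin n} (hxy : G.Adj x y) :
    (below T w (w s(x, y))).Reachable x y := by
  classical
  by_contra hn
  obtain ⟨⟨hle, hT⟩, hmin⟩ := h
  obtain ⟨p, hp⟩ := (hT.connected x y).exists_isPath
  have : ∃ f ∈ p.edges, w s(x, y) < w f := by
    by_contra! hc
    refine hn ⟨p.transfer _ fun e he => ?_⟩
    have h1 := p.edges_subset_edgeSet he
    have h2 := hc e he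
    induction e using Sym2.ind with
    | _ u v => exact ⟨h1, h2⟩
  obtain ⟨f, hf, hwf⟩ := this
  have hfT := p.edges_subset_edgeSet hf
  induction f using Sym2.ind with
  | _ a b =>
  have hnr : ¬ (T.deleteEdges {s(a, b)}).Reachable x y := by
    intro hr
    obtain ⟨q, hq⟩ := hr.exists_isPath
    have hle' : T.deleteEdges {s(a, b)} ≤ T := deleteEdges_le _
    have := (hT.isAcyclic.subsingleton_path x y).elim ⟨p, hp⟩ ⟨q.mapLe hle', hq.mapLe hle'⟩
    have hpq : p = q.mapLe hle' := congrArg Subtype.val this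
    rw [hpq, Walk.edges_mapLe_eq_edges] at hf
    have := q.edges_subset_edgeSet hf
    simp [edgeSet_deleteEdges] at this
  have h1 := totalWeight_exchange w (a := a) (b := b) hfT hnr
  have h2 := hmin _ ⟨sup_le ((deleteEdges_le _).trans hle) ?_, isTree_exchange hT hnr⟩
  · omega
  · rw [edge_le_iff]; exact Or.inr hxy

/-- Any competitor `T'` is moved towards `T` without gaining weight: remove an edge `s(x, y)`
outside `T`; the light path in `T` from `x` to `y` crosses the resulting cut, and its crossing edge
is the replacement. The induction is on the number of edges of `T'` outside `T`. -/
theorem isMST_of_reachable_below {n : ℕ} {G T : SimpleGraph (Fin n)} {w : Sym2 (Fin n) → ℤ}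
    (hle : T ≤ G) (hT : T.IsTree)
    (h : ∀ x y, G.Adj x y → (below T w (w s(x, y))).Reachable x y) : IsMST G w T := by
  classical
  refine ⟨⟨hle, hT⟩, ?_⟩
  suffices ∀ m, ∀ T', IsSpanningTree G T' → (T'.edgeSet \ T.edgeSet).ncard = m →
      totalWeight w T ≤ totalWeight w T' from fun T' hT' => this _ T' hT' rfl
  intro m
  induction m using Nat.strong_induction_on with
  | _ m ih =>
  intro T' hT' hm
  by_cases hsub : T'.edgeSet ⊆ T.edgeSet
  · have h1 : T' ≤ T := edgeSet_subset_edgeSet.1 hsub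
    have h2 : T ≤ T' := (isTree_iff_minimal_connected.1 hT).2 hT'.2.connected h1
    rw [le_antisymm h1 h2]
  · obtain ⟨e, he, hne⟩ := Set.not_subset.1 hsub
    induction e using Sym2.ind with
    | _ x y =>
    have hbr : ¬ (T'.deleteEdges {s(x, y)}).Reachable x y :=
      isBridge_iff.1 (isAcyclic_iff_forall_isBridge.1 hT'.2.isAcyclic he)
    obtain ⟨p⟩ := h x y (hT'.1 he)
    obtain ⟨dd, -, h1, h2⟩ := p.exists_boundary_dart
      {z | (T'.deleteEdges {s(x, y)}).Reachable x z} (Reachable.refl _) hbr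
    obtain ⟨⟨u, v⟩, huv⟩ := dd
    have hnr : ¬ (T'.deleteEdges {s(x, y)}).Reachable u v := fun hr => h2 (Reachable.trans h1 hr)
    have hne' : u ≠ v := huv.ne
    have hw := totalWeight_exchange w (a := x) (b := y) he hnr
    have htree := isTree_exchange hT'.2 hnr
    have hlt : ((T'.deleteEdges {s(x, y)} ⊔ edge u v).edgeSet \ T.edgeSet).ncard < m := by
      rw [← hm]
      apply Set.ncard_lt_ncard _ (Set.toFinite _)
      rw [Set.ssubset_iff_of_subset]
      · refine ⟨s(x, y), ⟨he, hne⟩, fun hc => ?_⟩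
        have hc1 := hc.1
        rw [edgeSet_sup, edgeSet_edge_of_ne hne', edgeSet_deleteEdges] at hc1
        rcases hc1 with hc1 | hc1
        · exact hc1.2 rfl
        · rw [Set.mem_singleton_iff] at hc1
          exact hne (hc1 ▸ huv.1)
      · rintro e ⟨he1, he2⟩
        rw [edgeSet_sup, edgeSet_edge_of_ne hne', edgeSet_deleteEdges] at he1
        rcases he1 with he1 | he1
        · exact ⟨he1.1, he2⟩
        · rw [Set.mem_singleton_iff] at he1
          exact absurd (he1 ▸ huv.1) he2
    have := ih _ hlt _ ⟨sup_le ((deleteEdges_le _).trans hT'.1)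
      (by rw [edge_le_iff]; exact Or.inr (hle huv.1)), htree⟩ rfl
    have : w s(u, v) ≤ w s(x, y) := huv.2
    omega

/-! ### Representatives along merging partitions -/

/-- Passing to a coarser equivalence relation, the representatives can be chosen so that a
representative changes only for elements whose class at least doubles. -/
theorem exists_representatives_of_le {V : Type*} [Finite V] {E E' : Setoid V} (hE : E ≤ E')
    {f : V → V} (hf : ∀ v, E v (f v)) (hfc : ∀ u v, E u v → f u = f v) :
    ∃ f' : V → V, (∀ v, E' v (f' v)) ∧ (∀ u v, E' u v → f' u = f' v) ∧
      ∀ v, f' v ≠ f v → 2 * {u | E v u}.ncard ≤ {u | E' v u}.ncard := by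
  have hmax : ∀ q : Quotient E', ∃ x, Quotient.mk E' x = q ∧
      ∀ y, Quotient.mk E' y = q → {u | E y u}.ncard ≤ {u | E x u}.ncard := by
    intro q
    obtain ⟨x, hx, hm⟩ := Set.exists_max_image {x | Quotient.mk E' x = q}
      (fun x => {u | E x u}.ncard) (Set.toFinite _) (Quotient.exists_rep q)
    exact ⟨x, hx, hm⟩
  -- `m q` lies in a largest `E`-class inside the `E'`-class `q`; that class keeps its
  -- representative. Any other part is disjoint from it and no larger, hence at most half of `q`.
  choose m hm hmm using hmax
  have hv : ∀ v, E' v (m (Quotient.mk E' v)) := fun v => E'.symm (Quotient.exact (hm _))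
  refine ⟨fun v => f (m (Quotient.mk E' v)), fun v => E'.trans (hv v) (hE (hf _)), ?_, ?_⟩
  · intro u v h
    have : Quotient.mk E' u = Quotient.mk E' v := Quotient.sound h
    simp only [this]
  · intro v hne
    have hnE : ¬ E v (m (Quotient.mk E' v)) := fun h => hne (hfc _ _ h).symm
    have hdisj : Disjoint {u | E v u} {u | E (m (Quotient.mk E' v)) u} :=
      Set.disjoint_left.2 fun u h1 h2 => hnE (E.trans h1 (E.symm h2))
    have hsub : {u | E v u} ∪ {u | E (m (Quotient.mk E' v)) u} ⊆ {u | E' v u} := by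
      rintro u (h | h)
      · exact hE h
      · exact E'.trans (hv v) (hE h)
    have h1 := Set.ncard_le_ncard hsub (Set.toFinite _)
    rw [Set.ncard_union_eq hdisj (Set.toFinite _) (Set.toFinite _)] at h1
    have h2 := hmm _ v rfl
    omega

/-- Along an increasing sequence of equivalence relations, representatives of the classes can be
chosen so that the representative of each element changes at most logarithmically often. -/
theorem exists_representatives_few_changes {V : Type*} [Finite V] [DecidableEq V] (E : ℕ → Setoid V)
    (hE : Monotone E) :
    ∃ f : ℕ → V → V, (∀ j v, E j v (f j v)) ∧ (∀ j u v, E j u v → f j u = f j v) ∧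
      ∀ J v, 2 ^ ((Finset.range J).filter fun j => f (j + 1) v ≠ f j v).card ≤ Nat.card V := by
  let Good : ℕ → (V → V) → Prop := fun j f => (∀ v, E j v (f v)) ∧ ∀ u v, E j u v → f u = f v
  have hstep : ∀ j, ∀ f : {f // Good j f}, ∃ f' : {f // Good (j + 1) f}, ∀ v, f'.1 v ≠ f.1 v →
      2 * {u | E j v u}.ncard ≤ {u | E (j + 1) v u}.ncard := by
    intro j f
    obtain ⟨f', h1, h2, h3⟩ :=
      exists_representatives_of_le (hE (Nat.le_succ j)) f.2.1 f.2.2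
    exact ⟨⟨f', h1, h2⟩, h3⟩
  choose step hs using hstep
  have base : Good 0 fun v => (Quotient.mk (E 0) v).out := by
    refine ⟨fun v => (E 0).symm (Quotient.exact (Quotient.out_eq _)), fun u v h => ?_⟩
    have : Quotient.mk (E 0) u = Quotient.mk (E 0) v := Quotient.sound h
    simp only [this]
  let F : ∀ j, {f // Good j f} := fun j =>
    Nat.rec (motive := fun j => {f // Good j f}) ⟨_, base⟩ step j
  refine ⟨fun j => (F j).1, fun j => (F j).2.1, fun j => (F j).2.2, fun J v => ?_⟩
  -- The class of `v` has at least one element and doubles at each change.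
  have key : 2 ^ ((Finset.range J).filter fun j => (F (j + 1)).1 v ≠ (F j).1 v).card ≤
      {u | E J v u}.ncard := by
    induction J with
    | zero =>
      simp only [Finset.range_zero, Finset.filter_empty, Finset.card_empty, pow_zero]
      exact (Set.ncard_pos (Set.toFinite _)).2 ⟨v, (E 0).refl v⟩
    | succ J ih =>
      rw [Finset.range_add_one, Finset.filter_insert]
      split_ifs with h
      · rw [Finset.card_insert_of_notMem (by simp), pow_succ]
        have : 2 * {u | E J v u}.ncard ≤ {u | E (J + 1) v u}.ncard := hs J (F J) v h
        omega
      · exact ih.trans (Set.ncard_le_ncard (fun u hu => hE (Nat.le_succ J) hu) (Set.toFinite _))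
  exact key.trans ((Set.ncard_le_ncard (Set.subset_univ _) (Set.toFinite _)).trans
    (Set.ncard_univ V).le)

/-! ### Compressing slowly changing level functions into bits -/

/-- The step function given by a list of (position, value) records, latest first, with the initial
value `x`. -/
def evalRecords {X : Type*} (x : X) : List (ℕ × X) → ℕ → X
  | [], _ => x
  | r :: l, j => if r.1 ≤ j then r.2 else evalRecords x l j

theorem exists_records {X : Type*} [DecidableEq X] (g : ℕ → X) (J : ℕ) :
    ∃ l : List (ℕ × X), l.length = ((Finset.range J).filter fun j => g (j + 1) ≠ g j).card ∧
      (∀ r ∈ l, r.1 ≤ J) ∧ ∀ j ≤ J, evalRecords (g 0) l j = g j := by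
  induction J with
  | zero =>
    refine ⟨[], by simp, by simp, ?_⟩
    intro j hj
    obtain rfl : j = 0 := by omega
    rfl
  | succ J ih =>
    obtain ⟨l, hl, hp, he⟩ := ih
    rw [Finset.range_add_one, Finset.filter_insert]
    split_ifs with h
    · refine ⟨(J + 1, g (J + 1)) :: l, ?_, ?_, ?_⟩
      · rw [Finset.card_insert_of_notMem (by simp), List.length_cons, hl]
      · intro r hr
        rcases List.mem_cons.1 hr with rfl | hr
        · exact le_rfl
        · exact (hp r hr).trans (Nat.le_succ J)
      · intro j hj
        by_cases hj' : j = J + 1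
        · subst hj'; simp [evalRecords]
        · rw [evalRecords, if_neg (by simp; omega)]
          exact he j (by omega)
    · refine ⟨l, hl, fun r hr => (hp r hr).trans (Nat.le_succ J), fun j hj => ?_⟩
      by_cases hj' : j = J + 1
      · subst hj'
        rw [not_not] at h
        rw [h, ← he J le_rfl]
        cases l with
        | nil => rfl
        | cons r l =>
          have := hp r (by simp)
          rw [evalRecords, evalRecords, if_pos this, if_pos (by omega)]
      · exact he j (by omega)

/-- A fixed length makes the encodings a finite product type that can be counted. Padding records
sit at position `J + 1`, so they are never active for `j ≤ J`. -/
theorem exists_records_length_eq {X : Type*} [DecidableEq X] (g : ℕ → X) {J L : ℕ}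
    (h : ((Finset.range J).filter fun j => g (j + 1) ≠ g j).card ≤ L) :
    ∃ l : List (ℕ × X), l.length = L ∧ (∀ r ∈ l, r.1 < J + 2) ∧
      ∀ j ≤ J, evalRecords (g 0) l j = g j := by
  induction L, h using Nat.le_induction with
  | base =>
    obtain ⟨l, h1, h2, h3⟩ := exists_records g J
    exact ⟨l, h1, fun r hr => by have := h2 r hr; omega, h3⟩
  | succ L _ ih =>
    obtain ⟨l, h1, h2, h3⟩ := ih
    refine ⟨(J + 1, g 0) :: l, by simp [h1], ?_, fun j hj => ?_⟩
    · intro r hr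
      rcases List.mem_cons.1 hr with rfl | hr
      · simp
      · exact h2 r hr
    · rw [evalRecords, if_neg (by simp; omega)]
      exact h3 j hj

/-- The information kept by a portal: its depth in the marked tree, and for every weight level
the identifier of the representative of its fragment and the distance to that representative. -/
structure PortalLabel (a n : ℕ) where
  depth : Fin n
  level : ℕ → Fin a × Fin n

/-- Portal labels whose levels change at most `L` times can be written with `s * b` bits. -/
theorem exists_portalDecoder (a n J L s b : ℕ) (ha : 0 < a) (hn : 0 < n)
    (hcard : n * (a * n) * ((J + 2) * (a * n)) ^ L ≤ 2 ^ (s * b)) :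
    ∃ dec : (Fin s → Fin b → Bool) → PortalLabel a n,
      ∀ (D : Fin n) (g : ℕ → Fin a × Fin n),
        ((Finset.range J).filter fun j => g (j + 1) ≠ g j).card ≤ L →
        ∃ B, (dec B).depth = D ∧ ∀ j ≤ J, (dec B).level j = g j := by
  have : NeZero a := ⟨ha.ne'⟩
  have : NeZero n := ⟨hn.ne'⟩
  let X := Fin a × Fin n
  let R := (Fin n × X) × (Fin L → Fin (J + 2) × X)
  have hle : Fintype.card R ≤ Fintype.card (Fin s → Fin b → Bool) := by
    have h2 : Fintype.card (Fin s → Fin b → Bool) = 2 ^ (s * b) := by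
      simp [← pow_mul, mul_comm]
    rw [h2]
    refine le_trans (le_of_eq ?_) hcard
    simp [R, X]
  obtain ⟨e⟩ := Function.Embedding.nonempty_of_card_le hle
  have hR : Nonempty R := ⟨((0, (0, 0)), fun _ => (0, (0, 0)))⟩
  -- The decoder depends on the parameters only, so prover and verifier share it.
  let ofR : R → PortalLabel a n := fun r =>
    ⟨r.1.1, evalRecords r.1.2 ((List.ofFn r.2).map fun q => ((q.1 : ℕ), q.2))⟩
  refine ⟨fun B => ofR (Function.invFun e B), fun D g hg => ?_⟩
  obtain ⟨l, hl, hp, he⟩ := exists_records_length_eq g hg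
  let r : R := ((D, g 0), fun i =>
    (⟨(l.get (i.cast hl.symm)).1, hp _ (List.get_mem _ _)⟩, (l.get (i.cast hl.symm)).2))
  refine ⟨e r, ?_⟩
  have hinv : Function.invFun e (e r) = r := Function.leftInverse_invFun e.injective r
  have hlist : (List.ofFn r.2).map (fun q => ((q.1 : ℕ), q.2)) = l := by
    apply List.ext_getElem
    · simp [hl]
    · intro i h1 h2
      simp [r]
  simp only [hinv]
  refine ⟨rfl, fun j hj => ?_⟩
  simp only [ofR, hlist]
  exact he j hj

/-! ### Node labels and the local check -/

/-- The content of the label of a node. -/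
structure NodeLabel where
  color : ZMod 3
  isPortal : Bool
  isMarked : Bool
  isRoot : Bool
  bits : ℕ → Bool

/-- Reading the content of the label of a node. -/
def NodeLabel.decode (l : List Bool) : NodeLabel where
  color := (l.getD 0 false).toNat + 2 * (l.getD 1 false).toNat
  isPortal := l.getD 2 false
  isMarked := l.getD 3 false
  isRoot := l.getD 4 false
  bits i := l.getD (i + 5) false

theorem NodeLabel.exists_decode_eq (c : ZMod 3) (p m r : Bool) {b : ℕ} (B : Fin b → Bool) :
    ∃ l : List Bool, l.length = b + 5 ∧ (decode l).color = c ∧ (decode l).isPortal = p ∧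
      (decode l).isMarked = m ∧ (decode l).isRoot = r ∧
      (fun i : Fin b => (decode l).bits i) = B := by
  have hc : ∀ c : ZMod 3, ∃ x y : Bool, ((x.toNat : ZMod 3) + 2 * (y.toNat : ZMod 3)) = c := by
    decide
  obtain ⟨x, y, hxy⟩ := hc c
  refine ⟨x :: y :: p :: m :: r :: List.ofFn B, by simp, by simpa [decode] using hxy, rfl, rfl, rfl,
    ?_⟩
  funext i
  simp [decode]

/-- A node as seen in a view: its identifier, its input and its label. -/
abbrev Rec : Type := ℕ × MSTInput × List Bool

/-- The content of the label of a node in a view. -/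
def Rec.lab (x : Rec) : NodeLabel := NodeLabel.decode x.2.2

/-- `y` is joined to `x` by a marked edge of weight at most `β`. -/
def MarkedStep (β : ℤ) (x y : Rec) : Prop := ∃ w ≤ β, (y.1, w, true) ∈ x.2.1

/-- `y` is reached from `x` by at most `m` marked edges of weight at most `β` inside `A`. -/
inductive ReachIn (A : Set Rec) (β : ℤ) : ℕ → Rec → Rec → Prop
  | refl (m : ℕ) (x : Rec) (hx : x ∈ A) : ReachIn A β m x x
  | tail {m : ℕ} {x y z : Rec} (h : ReachIn A β m x y) (hs : MarkedStep β y z) (hz : z ∈ A) :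
      ReachIn A β (m + 1) x z

/-- `z` continues the storage path that goes through `y`. -/
def StorageStep (y z : Rec) : Prop :=
  (∃ β, MarkedStep β y z) ∧ z.lab.isMarked = true ∧ z.lab.color = y.lab.color + 1

/-- The portal `x` stores `P`, spread over a path of `s` nodes inside `A`. -/
def Stored (A : Set Rec) {a n s b : ℕ} (dec : (Fin s → Fin b → Bool) → PortalLabel a n)
    (x : Rec) (P : PortalLabel a n) : Prop :=
  x.lab.isPortal = true ∧ ∃ g : ℕ → Rec, g 0 = x ∧ (∀ i < s, g i ∈ A) ∧
    (∀ i, i + 1 < s → StorageStep (g i) (g (i + 1))) ∧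
    dec (fun i j => (g i).lab.bits j) = P

theorem Stored.mono {A B : Set Rec} (hAB : A ⊆ B) {a n s b : ℕ}
    {dec : (Fin s → Fin b → Bool) → PortalLabel a n} {x : Rec} {P : PortalLabel a n}
    (h : Stored A dec x P) : Stored B dec x P := by
  obtain ⟨h1, g, h2, h3, h4⟩ := h
  exact ⟨h1, g, h2, fun i hi => hAB (h3 i hi), h4⟩

/-- The conditions on the marked neighbors of `x`: the colors orient the marked edges, every node
has at most one parent, roots have none, and at most one child continues a storage path. -/
def NeighborsOK (x y₁ y₂ : Rec) : Prop :=
  y₁.lab.color ≠ x.lab.color ∧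
  (x.lab.isRoot = true → y₁.lab.color ≠ x.lab.color - 1) ∧
  (y₁.lab.color = x.lab.color - 1 → y₂.lab.color = x.lab.color - 1 → y₁.1 = y₂.1) ∧
  (y₁.lab.isMarked = true → y₂.lab.isMarked = true → y₁.lab.color = x.lab.color + 1 →
    y₂.lab.color = x.lab.color + 1 → y₁.1 = y₂.1)

/-- The position of the weight `β` among the levels `0, …, 2 * N`. -/
def levelOf (N β : ℤ) : ℕ := (β + N).toNat

/-- The local check of the node `x` which sees the nodes `A`. -/
structure Accepts (N : ℤ) (K : ℕ) {a n s b : ℕ} (dec : (Fin s → Fin b → Bool) → PortalLabel a n)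
    (A : Set Rec) (x : Rec) : Prop where
  neighbors : ∀ e₁ ∈ x.2.1, ∀ e₂ ∈ x.2.1, e₁.2.2 = true → e₂.2.2 = true →
    ∃ y₁ ∈ A, ∃ y₂ ∈ A, y₁.1 = e₁.1 ∧ y₂.1 = e₂.1 ∧ NeighborsOK x y₁ y₂
  edges : ∀ e ∈ x.2.1, ∃ y ∈ A, y.1 = e.1 ∧ (ReachIn A e.2.1 K x y ∨
    ∃ p q P Q, ReachIn A e.2.1 K x p ∧ ReachIn A e.2.1 K y q ∧ Stored A dec p P ∧
      Stored A dec q Q ∧ (P.level (levelOf N e.2.1)).1 = (Q.level (levelOf N e.2.1)).1)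
  root : ∃ y, ReachIn A N K x y ∧ (y.lab.isRoot = true ∨ ∃ P, Stored A dec y P)
  portal : x.lab.isPortal = true → ∃ P, Stored A dec x P ∧
    (∃ y, ReachIn A N (K + 1) x y ∧
      (y.lab.isRoot = true ∨ ∃ Q, Stored A dec y Q ∧ Q.depth < P.depth)) ∧
    ∀ β, -N ≤ β → β ≤ N → x.1 = (P.level (levelOf N β)).1 ∨
      ∃ y Q, ReachIn A β (K + 1) x y ∧ Stored A dec y Q ∧
        (Q.level (levelOf N β)).1 = (P.level (levelOf N β)).1 ∧
        (Q.level (levelOf N β)).2 < (P.level (levelOf N β)).2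

/-- The record of the node `u`. -/
def Config.record {k n : ℕ} (c : Config MSTInput k n) (l : Fin n → List Bool) (u : Fin n) : Rec :=
  (c.id u, c.input u, l u)

/-! ### Translating views into graph statements -/

section Records

variable {d k n : ℕ} {c : Config MSTInput k n} {w : Sym2 (Fin n) → ℤ} {T : SimpleGraph (Fin n)}

theorem Encodes.mem_input (h : Encodes d c w T) {u : Fin n} {e : ℕ × ℤ × Bool} :
    e ∈ c.input u ↔ ∃ v, c.graph.Adj u v ∧ e.1 = c.id v ∧ e.2.1 = w s(u, v) ∧
      (e.2.2 = true ↔ T.Adj u v) := by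
  classical
  obtain ⟨i, β, t⟩ := e
  rw [h.2.2 u, mstInput]
  simp only [Finset.mem_image, mem_neighborFinset, Prod.mk.injEq]
  constructor
  · rintro ⟨v, hv, rfl, rfl, rfl⟩
    exact ⟨v, hv, rfl, rfl, by simp⟩
  · rintro ⟨v, hv, rfl, rfl, ht⟩
    refine ⟨v, hv, rfl, rfl, ?_⟩
    rw [Bool.eq_iff_iff, decide_eq_true_iff]
    exact ht.symm

theorem Encodes.markedStep_iff (h : Encodes d c w T) (l : Fin n → List Bool) {β : ℤ}
    {u v : Fin n} : MarkedStep β (c.record l u) (c.record l v) ↔ (below T w β).Adj u v := by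
  constructor
  · rintro ⟨w', hw, hm⟩
    obtain ⟨v', -, h2, h3, h4⟩ := h.mem_input.1 hm
    obtain rfl : v = v' := c.id_injective h2
    simp only at h3 h4
    exact ⟨h4.1 trivial, h3 ▸ hw⟩
  · rintro ⟨hT, hw⟩
    exact ⟨_, hw, h.mem_input.2 ⟨v, h.2.1 hT, rfl, rfl, by simpa using hT⟩⟩

theorem Encodes.reachable_of_reachIn (h : Encodes d c w T) {l : Fin n → List Bool} {A : Set Rec}
    (hA : A ⊆ Set.range (c.record l)) {β : ℤ} {m : ℕ} {u : Fin n} {y : Rec}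
    (hr : ReachIn A β m (c.record l u) y) :
    ∃ v, y = c.record l v ∧ (below T w β).Reachable u v := by
  generalize hx : c.record l u = x at hr
  induction hr with
  | refl m x hxA => exact ⟨u, hx.symm, Reachable.refl _⟩
  | tail _ hs hz ih =>
    obtain ⟨v, rfl, hv⟩ := ih hx
    obtain ⟨v', rfl⟩ := hA hz
    exact ⟨v', rfl, hv.trans ((h.markedStep_iff l).1 hs).reachable⟩

theorem Config.record_injective (c : Config MSTInput k n) (l : Fin n → List Bool) :
    Function.Injective (c.record l) := fun _ _ h => c.id_injective (congrArg Prod.fst h)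

/-- A connected graph whose edges are oriented by colors modulo 3, with at most one parent for each
node and none for some node, is a tree. -/
theorem isTree_of_colors {V : Type*} [Finite V] {T : SimpleGraph V} (hT : T.Connected)
    (col : V → ZMod 3) (hne : ∀ u v, T.Adj u v → col v ≠ col u)
    (hpar : ∀ u v v', T.Adj u v → T.Adj u v' → col v = col u - 1 → col v' = col u - 1 → v = v')
    (r : V) (hr : ∀ v, T.Adj r v → col v ≠ col r - 1) : T.IsTree := by
  classical
  -- The edge from `v` to its parent, with a loop as dummy value. The images of the nodes other than
  -- `r` cover all edges, so there are fewer edges than nodes.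
  let f : V → Sym2 V := fun v =>
    if h : ∃ u, T.Adj v u ∧ col u = col v - 1 then s(h.choose, v) else s(v, v)
  have hcol : ∀ a b : ZMod 3, a ≠ b → a = b - 1 ∨ b = a - 1 := by decide
  have hf : ∀ u v, T.Adj v u → col u = col v - 1 → s(u, v) ∈ f '' {r}ᶜ := by
    intro u v hadj hc
    refine ⟨v, fun hv => hr u ?_ ?_, ?_⟩
    · rw [Set.mem_singleton_iff] at hv; exact hv ▸ hadj
    · rw [Set.mem_singleton_iff] at hv; exact hv ▸ hc
    · have hex : ∃ u, T.Adj v u ∧ col u = col v - 1 := ⟨u, hadj, hc⟩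
      simp only [f, dif_pos hex]
      rw [hpar v _ u hex.choose_spec.1 hadj hex.choose_spec.2 hc]
  have hsub : T.edgeSet ⊆ f '' {r}ᶜ := by
    intro e
    induction e using Sym2.ind with
    | _ u v =>
    intro he
    rw [mem_edgeSet] at he
    rcases hcol _ _ (hne u v he) with h | h
    · rw [Sym2.eq_swap]; exact hf v u he h
    · exact hf u v he.symm h
  have h1 : T.edgeSet.ncard ≤ ({r}ᶜ : Set V).ncard :=
    (Set.ncard_le_ncard hsub (Set.toFinite _)).trans (Set.ncard_image_le (Set.toFinite _))
  have h2 : ({r}ᶜ : Set V).ncard + 1 = Nat.card V := by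
    have := Set.ncard_add_ncard_compl ({r} : Set V)
    rw [Set.ncard_singleton] at this
    omega
  have h3 := hT.card_vert_le_card_edgeSet_add_one
  rw [isTree_iff_connected_and_card]
  refine ⟨hT, ?_⟩
  have h4 : Nat.card T.edgeSet = T.edgeSet.ncard := rfl
  omega

end Records

/-! ### Soundness -/

section Soundness

variable {d k n K a s b : ℕ} {c : Config MSTInput k n} {w : Sym2 (Fin n) → ℤ}
  {T : SimpleGraph (Fin n)} {dec : (Fin s → Fin b → Bool) → PortalLabel a n} {N : ℤ}
  {l : Fin n → List Bool} {A : Fin n → Set Rec}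

theorem Encodes.neighborsOK (h : Encodes d c w T)
    (hA : ∀ v, A v ⊆ Set.range (c.record l)) (hacc : ∀ v, Accepts N K dec (A v) (c.record l v))
    {u v₁ v₂ : Fin n} (h₁ : T.Adj u v₁) (h₂ : T.Adj u v₂) :
    NeighborsOK (c.record l u) (c.record l v₁) (c.record l v₂) := by
  obtain ⟨y₁, hy₁, y₂, hy₂, he₁, he₂, hok⟩ := (hacc u).neighbors
    (c.id v₁, w s(u, v₁), true) (h.mem_input.2 ⟨v₁, h.2.1 h₁, rfl, rfl, by simpa using h₁⟩)
    (c.id v₂, w s(u, v₂), true) (h.mem_input.2 ⟨v₂, h.2.1 h₂, rfl, rfl, by simpa using h₂⟩) rfl rfl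
  obtain ⟨x₁, rfl⟩ := hA u hy₁
  obtain ⟨x₂, rfl⟩ := hA u hy₂
  obtain rfl : x₁ = v₁ := c.id_injective he₁
  obtain rfl : x₂ = v₂ := c.id_injective he₂
  exact hok

/-- At most one marked child continues a storage path, so the path is forced from its portal on.
Hence all nodes read the same certificate at a portal, whatever the labeling. -/
theorem Encodes.stored_unique (h : Encodes d c w T)
    (hA : ∀ v, A v ⊆ Set.range (c.record l)) (hacc : ∀ v, Accepts N K dec (A v) (c.record l v))
    {x : Rec} {P Q : PortalLabel a n} (hP : Stored (Set.range (c.record l)) dec x P)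
    (hQ : Stored (Set.range (c.record l)) dec x Q) : P = Q := by
  obtain ⟨-, g, h1, h2, h3, rfl⟩ := hP
  obtain ⟨-, g', h1', h2', h3', rfl⟩ := hQ
  have key : ∀ i < s, g i = g' i := by
    intro i
    induction i with
    | zero => intro _; rw [h1, h1']
    | succ i ih =>
      intro hi
      have hgi := ih (by omega)
      obtain ⟨u, hu⟩ := h2 i (by omega)
      obtain ⟨v, hv⟩ := h2 (i + 1) hi
      obtain ⟨v', hv'⟩ := h2' (i + 1) hi
      have e1 := h3 i hi
      have e2 := h3' i hi
      rw [← hgi, ← hu, ← hv'] at e2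
      rw [← hu, ← hv] at e1
      rw [← hv, ← hv']
      obtain ⟨⟨_, m1⟩, m2, m3⟩ := e1
      obtain ⟨⟨_, m1'⟩, m2', m3'⟩ := e2
      have := (h.neighborsOK hA hacc ((h.markedStep_iff l).1 m1).1
        ((h.markedStep_iff l).1 m1').1).2.2.2 m2 m2' m3 m3'
      rw [c.id_injective this]
  congr 1
  funext i j
  rw [key i i.2]

/-- Induction on the claimed distance: the check leads, within the fragment, to a portal with the
same name and a smaller distance, until the named node itself is found. The distances need not be
correct. -/
theorem Encodes.reachable_representative (h : Encodes d c w T)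
    (hA : ∀ v, A v ⊆ Set.range (c.record l)) (hacc : ∀ v, Accepts N K dec (A v) (c.record l v))
    {β : ℤ} (h1 : -N ≤ β) (h2 : β ≤ N) (u : Fin n) (P : PortalLabel a n)
    (hP : Stored (Set.range (c.record l)) dec (c.record l u) P) :
    ∃ v, c.id v = (P.level (levelOf N β)).1 ∧ (below T w β).Reachable u v := by
  induction hD : (P.level (levelOf N β)).2 using WellFoundedLT.induction generalizing u P with
  | _ D ih =>
  obtain ⟨P', hP', -, hlev⟩ := (hacc u).portal hP.1
  obtain rfl : P' = P := h.stored_unique hA hacc (hP'.mono (hA u)) hP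
  rcases hlev β h1 h2 with he | ⟨y, Q, hr, hQ, e1, e2⟩
  · exact ⟨u, he, Reachable.refl _⟩
  · obtain ⟨v, rfl, hv⟩ := h.reachable_of_reachIn (hA u) hr
    obtain ⟨z, hz, hz'⟩ := ih _ (hD ▸ e2) v Q (hQ.mono (hA u)) rfl
    exact ⟨z, by rw [hz, e1], hv.trans hz'⟩

/-- Following portals of decreasing claimed depth must end at a node flagged as root. -/
theorem Encodes.exists_root (h : Encodes d c w T)
    (hA : ∀ v, A v ⊆ Set.range (c.record l)) (hacc : ∀ v, Accepts N K dec (A v) (c.record l v)) :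
    ∃ r, (c.record l r).lab.isRoot = true := by
  have key : ∀ u P, Stored (Set.range (c.record l)) dec (c.record l u) P →
      ∃ r, (c.record l r).lab.isRoot = true := by
    intro u P hP
    induction hD : P.depth using WellFoundedLT.induction generalizing u P with
    | _ D ih =>
    obtain ⟨P', hP', ⟨y, hy, hroot⟩, -⟩ := (hacc u).portal hP.1
    obtain rfl : P' = P := h.stored_unique hA hacc (hP'.mono (hA u)) hP
    obtain ⟨v, rfl, -⟩ := h.reachable_of_reachIn (hA u) hy
    rcases hroot with hr | ⟨Q, hQ, hlt⟩
    · exact ⟨v, hr⟩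
    · exact ih _ (hD ▸ hlt) v Q (hQ.mono (hA u)) rfl
  obtain ⟨u⟩ := c.connected.nonempty
  obtain ⟨y, hy, hroot⟩ := (hacc u).root
  obtain ⟨v, rfl, -⟩ := h.reachable_of_reachIn (hA u) hy
  rcases hroot with hr | ⟨Q, hQ⟩
  · exact ⟨v, hr⟩
  · exact key v Q (hQ.mono (hA u))

theorem Encodes.isMST_of_accepts (h : Encodes d c w T) (hN : N = (n : ℤ) ^ d)
    (hA : ∀ v, A v ⊆ Set.range (c.record l)) (hacc : ∀ v, Accepts N K dec (A v) (c.record l v)) :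
    IsMST c.graph w T := by
  have hedge : ∀ x y, c.graph.Adj x y → (below T w (w s(x, y))).Reachable x y := by
    intro x y hxy
    have hw := abs_le.1 (h.1 s(x, y) hxy)
    rw [← hN] at hw
    obtain ⟨z, hz, hid, hor⟩ := (hacc x).edges
      (c.id y, w s(x, y), open Classical in decide (T.Adj x y))
      (h.mem_input.2 ⟨y, hxy, rfl, rfl, by simp⟩)
    obtain ⟨y', rfl⟩ := hA x hz
    obtain rfl : y' = y := c.id_injective hid
    rcases hor with hr | ⟨p, q, P, Q, hp, hq, hP, hQ, he⟩
    · obtain ⟨v, hv, hr⟩ := h.reachable_of_reachIn (hA x) hr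
      obtain rfl := c.record_injective l hv
      exact hr
    · obtain ⟨p, rfl, hxp⟩ := h.reachable_of_reachIn (hA x) hp
      obtain ⟨q, rfl, hyq⟩ := h.reachable_of_reachIn (hA x) hq
      obtain ⟨z, hz, hpz⟩ := h.reachable_representative hA hacc hw.1 hw.2 p P (hP.mono (hA x))
      obtain ⟨z', hz', hqz⟩ := h.reachable_representative hA hacc hw.1 hw.2 q Q (hQ.mono (hA x))
      simp only at he
      rw [← he, ← hz] at hz'
      obtain rfl := c.id_injective hz'
      exact (hxp.trans hpz).trans (hyq.trans hqz).symm
  have hconn : T.Connected := by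
    have := c.connected.nonempty
    refine ⟨fun u v => ?_⟩
    obtain ⟨p⟩ := c.connected u v
    induction p with
    | nil => exact Reachable.refl _
    | cons hadj _ ih => exact ((hedge _ _ hadj).mono (below_le _ _ _)).trans ih
  obtain ⟨r, hr⟩ := h.exists_root hA hacc
  refine isMST_of_reachable_below h.2.1 ?_ hedge
  refine isTree_of_colors hconn (fun u => (c.record l u).lab.color)
    (fun u v huv => (h.neighborsOK hA hacc huv huv).1) (fun u v v' h1 h2 e1 e2 => ?_) r
    (fun v hrv => (h.neighborsOK hA hacc hrv hrv).2.1 hr)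
  exact c.id_injective ((h.neighborsOK hA hacc h1 h2).2.2.1 e1 e2)

end Soundness

/-! ### Rooted trees, portals and storage paths -/

/-- Parents and depths of a rooted tree. -/
structure Rooting {V : Type*} (T : SimpleGraph V) where
  par : V → V
  dep : V → ℕ
  adj_par : ∀ x, dep x ≠ 0 → T.Adj x (par x)
  dep_par : ∀ x, dep x ≠ 0 → dep (par x) + 1 = dep x
  eq_par : ∀ x y, T.Adj x y → dep y + 1 = dep x ∧ par x = y ∨ dep x + 1 = dep y ∧ par y = x

theorem length_eq_dist_of_isPath {V : Type*} {T : SimpleGraph V} (hT : T.IsTree) {u v : V}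
    {p : T.Walk u v} (hp : p.IsPath) : p.length = T.dist u v := by
  obtain ⟨q, hq, hl⟩ := hT.connected.exists_path_of_dist u v
  have : p = q :=
    congrArg Subtype.val ((hT.isAcyclic.subsingleton_path u v).elim ⟨p, hp⟩ ⟨q, hq⟩)
  rw [this, hl]

theorem exists_rooting {V : Type*} {T : SimpleGraph V} (hT : T.IsTree) (r : V) :
    ∃ R : Rooting T, ∀ x, R.dep x = T.dist r x := by
  have hex : ∀ x, ∃ y, T.dist r x ≠ 0 → T.Adj x y ∧ T.dist r y + 1 = T.dist r x := by
    intro x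
    by_cases h0 : T.dist r x = 0
    · exact ⟨x, fun h => absurd h0 h⟩
    obtain ⟨p, hp, hl⟩ := hT.connected.exists_path_of_dist r x
    have hnil : ¬ p.Nil := by
      rw [← Walk.length_eq_zero_iff]
      omega
    refine ⟨p.penultimate, fun _ => ⟨(p.adj_penultimate hnil).symm, ?_⟩⟩
    have h1 := length_eq_dist_of_isPath hT hp.dropLast
    rw [← h1, ← hl]
    simp only [Walk.length_dropLast]
    omega
  choose par hpar using hex
  have huniq : ∀ x y y', T.Adj x y → T.Adj x y' → T.dist r y + 1 = T.dist r x →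
      T.dist r y' + 1 = T.dist r x → y = y' := by
    intro x y y' h h' e e'
    obtain ⟨p, -, hl⟩ := hT.connected.exists_path_of_dist r y
    obtain ⟨p', -, hl'⟩ := hT.connected.exists_path_of_dist r y'
    have hp := (p.concat h.symm).isPath_of_length_eq_dist (by rw [Walk.length_concat]; omega)
    have hp' := (p'.concat h'.symm).isPath_of_length_eq_dist (by rw [Walk.length_concat]; omega)
    have : p.concat h.symm = p'.concat h'.symm :=
      congrArg Subtype.val ((hT.isAcyclic.subsingleton_path r x).elim ⟨_, hp⟩ ⟨_, hp'⟩)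
    have := congrArg Walk.penultimate this
    simpa using this
  refine ⟨⟨par, fun x => T.dist r x, fun x h => (hpar x h).1, fun x h => (hpar x h).2, ?_⟩,
    fun _ => rfl⟩
  intro x y hxy
  rcases hT.dist_eq_dist_add_one_of_adj r hxy with h | h
  · have := hpar x (by omega)
    exact Or.inl ⟨h.symm, huniq x _ _ this.1 hxy this.2 h.symm⟩
  · have := hpar y (by omega)
    exact Or.inr ⟨h.symm, huniq y _ _ this.1 hxy.symm this.2 h.symm⟩

namespace Rooting

variable {V : Type*} {T : SimpleGraph V} (R : Rooting T)

theorem dep_iterate (x : V) {i : ℕ} (hi : i ≤ R.dep x) : R.dep (R.par^[i] x) + i = R.dep x := by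
  induction i with
  | zero => rfl
  | succ i ih =>
    have h1 := ih (by omega)
    have h2 := R.dep_par (R.par^[i] x) (by omega)
    rw [Function.iterate_succ_apply']
    omega

/-- A portal for the spacing `s`: its depth is divisible by `s`, and it has a descendant `s - 1`
levels below. -/
def IsPortal (s : ℕ) (x : V) : Prop :=
  s ∣ R.dep x ∧ ∃ y, R.dep y = R.dep x + (s - 1) ∧ R.par^[s - 1] y = x

theorem exists_portal_above {s : ℕ} (hs : 0 < s) (y : V) (hy : 2 * (s - 1) ≤ R.dep y) :
    ∃ i ≤ 2 * (s - 1), R.IsPortal s (R.par^[i] y) := by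
  have hmod := Nat.mod_lt (R.dep y - (s - 1)) hs
  have hdiv := Nat.dvd_sub_mod (n := s) (R.dep y - (s - 1))
  set i := (R.dep y - (s - 1)) % s with hi
  have hle : i ≤ R.dep y - (s - 1) := Nat.mod_le _ _
  -- Climbing `i` steps reaches depth congruent to `s - 1` modulo `s`; this node witnesses that its
  -- ancestor `s - 1` levels higher is a portal.
  refine ⟨s - 1 + i, by omega, ?_, R.par^[i] y, ?_, ?_⟩
  · have := R.dep_iterate y (i := s - 1 + i) (by omega)
    have h2 : R.dep (R.par^[s - 1 + i] y) = R.dep y - (s - 1) - i := by omega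
    rw [h2]
    exact hdiv
  · have h1 := R.dep_iterate y (i := s - 1 + i) (by omega)
    have h2 := R.dep_iterate y (i := i) (by omega)
    omega
  · rw [← Function.iterate_add_apply]

/-- Every sequence of `4 * (s - 1)` tree edges without immediate return meets a portal. -/
theorem exists_portal_of_chain {s : ℕ} (hs : 0 < s) (g : ℕ → V)
    (hadj : ∀ i < 4 * (s - 1), T.Adj (g i) (g (i + 1)))
    (hne : ∀ i, i + 2 ≤ 4 * (s - 1) → g i ≠ g (i + 2)) :
    ∃ i ≤ 4 * (s - 1), R.IsPortal s (g i) := by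
  -- After a downward step the only way up is back to the parent, so the chain keeps descending.
  have hdown : ∀ i, i + 2 ≤ 4 * (s - 1) →
      R.dep (g i) + 1 = R.dep (g (i + 1)) ∧ R.par (g (i + 1)) = g i →
      R.dep (g (i + 1)) + 1 = R.dep (g (i + 2)) ∧ R.par (g (i + 2)) = g (i + 1) := by
    intro i hi hp
    rcases R.eq_par _ _ (hadj (i + 1) (by omega)) with h | h
    · exact absurd (hp.2.symm.trans h.2) (hne i hi)
    · exact h
  have hdowns : ∀ i m, i + m + 1 ≤ 4 * (s - 1) →
      R.dep (g i) + 1 = R.dep (g (i + 1)) ∧ R.par (g (i + 1)) = g i →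
      R.dep (g (i + m)) + 1 = R.dep (g (i + m + 1)) ∧ R.par (g (i + m + 1)) = g (i + m) := by
    intro i m
    induction m with
    | zero => intro _ h; exact h
    | succ m ih => intro hm h; exact hdown (i + m) (by omega) (ih (by omega) h)
  obtain ⟨h, hh⟩ : ∃ h, h = 2 * (s - 1) := ⟨_, rfl⟩
  rcases Nat.eq_zero_or_pos h with h0 | h0
  · obtain ⟨i, hi, hp⟩ := R.exists_portal_above hs (g 0) (by omega)
    obtain rfl : i = 0 := by omega
    exact ⟨0, by omega, hp⟩
  -- By the direction at the midpoint, either the first half only ascends or the second half only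
  -- descends; that half is a vertical path of length `2 * (s - 1)`.
  rcases R.eq_par _ _ (hadj h (by omega)) with hup | hdn
  · have hall : ∀ i ≤ h, R.dep (g (i + 1)) + 1 = R.dep (g i) ∧ R.par (g i) = g (i + 1) := by
      intro i hi
      rcases R.eq_par _ _ (hadj i (by omega)) with h1 | h1
      · exact h1
      · have := (hdowns i (h - i) (by omega) h1).1
        rw [show i + (h - i) = h by omega] at this
        omega
    have hiter : ∀ i ≤ h, R.par^[i] (g 0) = g i ∧ R.dep (g i) + i = R.dep (g 0) := by
      intro i
      induction i with
      | zero => intro _; exact ⟨rfl, rfl⟩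
      | succ i ih =>
        intro hi
        have h1 := ih (by omega)
        have h2 := hall i (by omega)
        rw [Function.iterate_succ_apply', h1.1]
        exact ⟨h2.2, by omega⟩
    have h1 := hiter h le_rfl
    obtain ⟨i, hi, hp⟩ := R.exists_portal_above hs (g 0) (by omega)
    rw [(hiter i (by omega)).1] at hp
    exact ⟨i, by omega, hp⟩
  · have hiter : ∀ i ≤ h, R.par^[i] (g (h + h)) = g (h + h - i) ∧
        R.dep (g (h + h - i)) + i = R.dep (g (h + h)) := by
      intro i
      induction i with
      | zero => intro _; exact ⟨rfl, rfl⟩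
      | succ i ih =>
        intro hi
        have h1 := ih (by omega)
        have h2 := hdowns h (h - (i + 1)) (by omega) hdn
        rw [show h + (h - (i + 1)) + 1 = h + h - i by omega,
          show h + (h - (i + 1)) = h + h - (i + 1) by omega] at h2
        rw [Function.iterate_succ_apply', h1.1]
        exact ⟨h2.2, by omega⟩
    have h1 := hiter h le_rfl
    obtain ⟨i, hi, hp⟩ := R.exists_portal_above hs (g (h + h)) (by omega)
    rw [(hiter i (by omega)).1] at hp
    exact ⟨h + h - i, by omega, hp⟩

theorem exists_portal_of_isPath {s : ℕ} (hs : 0 < s) {H : SimpleGraph V} (hH : H ≤ T) {u v : V}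
    {p : H.Walk u v} (hp : p.IsPath) {j : ℕ} (hj : j + 4 * (s - 1) ≤ p.length) :
    ∃ i, j ≤ i ∧ i ≤ j + 4 * (s - 1) ∧ R.IsPortal s (p.getVert i) := by
  obtain ⟨i, hi, h⟩ := R.exists_portal_of_chain hs (fun i => p.getVert (j + i))
    (fun i hi => hH (p.adj_getVert_succ (by omega))) (fun i hi he => by
      have := hp.getVert_injOn (show j + i ≤ p.length by omega)
        (show j + (i + 2) ≤ p.length by omega) he
      omega)
  exact ⟨j + i, by omega, by omega, h⟩

open Classical in
/-- The lower end of the storage path of a portal. -/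
noncomputable def tip (s : ℕ) (x : V) : V :=
  if h : ∃ y, R.dep y = R.dep x + (s - 1) ∧ R.par^[s - 1] y = x then h.choose else x

/-- The `i`-th node of the storage path of a portal. -/
noncomputable def storage (s : ℕ) (x : V) (i : ℕ) : V := R.par^[s - 1 - i] (R.tip s x)

variable {R} {s : ℕ} {x : V}

theorem IsPortal.tip_spec (h : R.IsPortal s x) :
    R.dep (R.tip s x) = R.dep x + (s - 1) ∧ R.par^[s - 1] (R.tip s x) = x := by
  have hex := h.2
  rw [tip, dif_pos hex]
  exact hex.choose_spec

theorem IsPortal.storage_zero (h : R.IsPortal s x) : R.storage s x 0 = x := h.tip_spec.2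

theorem IsPortal.dep_storage (h : R.IsPortal s x) {i : ℕ} (hi : i < s) :
    R.dep (R.storage s x i) = R.dep x + i := by
  have h1 := R.dep_iterate (R.tip s x) (i := s - 1 - i) (by rw [h.tip_spec.1]; omega)
  rw [h.tip_spec.1] at h1
  rw [storage]
  omega

theorem par_storage {i : ℕ} (hi : i + 1 < s) :
    R.par (R.storage s x (i + 1)) = R.storage s x i := by
  rw [storage, storage, ← Function.iterate_succ_apply' R.par]
  congr 1
  omega

theorem IsPortal.adj_storage (h : R.IsPortal s x) {i : ℕ} (hi : i + 1 < s) :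
    T.Adj (R.storage s x i) (R.storage s x (i + 1)) := by
  have := R.adj_par (R.storage s x (i + 1)) (by rw [h.dep_storage hi]; omega)
  rw [par_storage hi] at this
  exact this.symm

theorem IsPortal.dep_storage_mod (h : R.IsPortal s x) {i : ℕ} (hi : i < s) :
    R.dep (R.storage s x i) % s = i := by
  rw [h.dep_storage hi, Nat.add_mod, Nat.mod_eq_zero_of_dvd h.1]
  simp [Nat.mod_eq_of_lt hi]

theorem IsPortal.iterate_storage (h : R.IsPortal s x) {i : ℕ} (hi : i < s) :
    R.par^[i] (R.storage s x i) = x := by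
  rw [storage, ← Function.iterate_add_apply]
  conv_rhs => rw [← h.tip_spec.2]
  congr 1
  omega

variable (R s) in
/-- The top of the segment of spacing `s` that contains the node `z`. -/
def top (z : V) : V := R.par^[R.dep z % s] z

variable (R s) in
/-- The node `z` continues a storage path that starts higher up. -/
def IsMarked (z : V) : Prop :=
  0 < R.dep z % s ∧ R.IsPortal s (R.top s z) ∧ R.storage s (R.top s z) (R.dep z % s) = z

theorem IsPortal.top_storage (h : R.IsPortal s x) {i : ℕ} (hi : i < s) :
    R.top s (R.storage s x i) = x := by
  rw [top, h.dep_storage_mod hi, h.iterate_storage hi]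

theorem IsPortal.isMarked_storage (h : R.IsPortal s x) {i : ℕ} (hi : i + 1 < s) :
    R.IsMarked s (R.storage s x (i + 1)) := by
  refine ⟨?_, ?_, ?_⟩
  · rw [h.dep_storage_mod hi]; omega
  · rwa [h.top_storage hi]
  · rw [h.top_storage hi, h.dep_storage_mod hi]

/-- Marked nodes are not tops of segments, so siblings share their top, and the storage path of that
top has one node at each depth. -/
theorem IsMarked.eq_of_par_eq {y z : V} (hy : R.IsMarked s y) (hz : R.IsMarked s z)
    (hd : R.dep y = R.dep z) (hp : R.par y = R.par z) : y = z := by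
  have htop : R.top s y = R.top s z := by
    have h0 := hy.1
    obtain ⟨m, hm⟩ : ∃ m, R.dep y % s = m + 1 := ⟨R.dep y % s - 1, by omega⟩
    rw [top, top, ← hd, hm, Function.iterate_succ_apply, Function.iterate_succ_apply, hp]
  rw [← hy.2.2, ← hz.2.2, htop, hd]

end Rooting

/-! ### Completeness -/

section Completeness

variable {d k n : ℕ} {c : Config MSTInput k n} {w : Sym2 (Fin n) → ℤ} {T : SimpleGraph (Fin n)}

theorem ReachIn.mono {A : Set Rec} {β : ℤ} {m m' : ℕ} {x y : Rec} (h : ReachIn A β m x y)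
    (hm : m ≤ m') : ReachIn A β m' x y := by
  induction h generalizing m' with
  | refl m x hx => exact .refl m' x hx
  | tail _ hs hz ih =>
    obtain ⟨q, rfl⟩ : ∃ q, m' = q + 1 := ⟨m' - 1, by omega⟩
    exact .tail (ih (by omega)) hs hz

theorem Config.record_mem_view (c : Config MSTInput k n) (l : Fin n → List Bool) {t : ℕ}
    {v u : Fin n} (h : c.graph.dist v u ≤ t) : c.record l u ∈ (c.view l t v).nodes := ⟨u, h, rfl⟩

theorem Encodes.reachIn_of_walk (h : Encodes d c w T) (l : Fin n → List Bool) {t : ℕ} {β : ℤ}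
    {u u' v : Fin n} (p : (below T w β).Walk u u') {m : ℕ} (hm : p.length ≤ m)
    (ht : c.graph.dist v u + m ≤ t) :
    ReachIn (c.view l t v).nodes β m (c.record l u) (c.record l u') := by
  refine ReachIn.mono ?_ hm
  have hp : c.graph.dist v u + p.length ≤ t := by omega
  clear hm ht
  induction p using Walk.concatRec with
  | Hnil => exact .refl _ _ (c.record_mem_view l (by simpa using hp))
  | Hconcat p hadj ih =>
    rename_i u₁ u₂ u₃
    rw [Walk.length_concat] at hp ⊢
    refine .tail (ih (by omega)) ((h.markedStep_iff l).2 hadj) (c.record_mem_view l ?_)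
    have hle : below T w β ≤ c.graph := (below_le _ _ _).trans h.2.1
    have h1 := c.graph.dist_le ((p.concat hadj).mapLe hle)
    rw [Walk.length_mapLe, Walk.length_concat] at h1
    have := c.connected.dist_triangle (u := v) (v := u₁) (w := u₃)
    omega

theorem _root_.SimpleGraph.Connected.dist_lt_card {V : Type*} [Fintype V] {G : SimpleGraph V}
    (hG : G.Connected) (u v : V) : G.dist u v < Fintype.card V := by
  obtain ⟨p, hp, hl⟩ := hG.exists_path_of_dist u v
  rw [← hl]
  exact hp.length_lt

/-- The labels of the portals: the representatives of the fragments at all levels. -/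
theorem exists_portalLabels (hT : T.Connected) {N : ℤ} {a J s b : ℕ} (id : Fin n → Fin a)
    (D : Fin n → Fin n) (dec : (Fin s → Fin b → Bool) → PortalLabel a n)
    (hdec : ∀ (D : Fin n) (g : ℕ → Fin a × Fin n),
      ((Finset.range J).filter fun j => g (j + 1) ≠ g j).card ≤ Nat.log 2 n →
      ∃ B, (dec B).depth = D ∧ ∀ j ≤ J, (dec B).level j = g j)
    (Portal : Fin n → Prop) :
    ∃ (B : Fin n → Fin s → Fin b → Bool) (f : ℕ → Fin n → Fin n), ∀ x, Portal x →
      (dec (B x)).depth = D x ∧ ∀ j ≤ J, Portal (f j x) ∧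
        (below T w (j - N)).Reachable x (f j x) ∧
        (∀ y, Portal y → (below T w (j - N)).Reachable x y → f j x = f j y) ∧
        ((dec (B x)).level j).1 = id (f j x) ∧
        (((dec (B x)).level j).2 : ℕ) = T.dist x (f j x) := by
  classical
  -- Only portals are partitioned, so that every representative is itself a portal.
  let E : ℕ → Setoid {x // Portal x} := fun j =>
    ((below T w (j - N)).reachableSetoid).comap Subtype.val
  have hE : Monotone E := by
    intro i j hij x y hxy
    exact Reachable.mono (below_mono T w (by omega)) hxy
  obtain ⟨f, h1, h2, h3⟩ := exists_representatives_few_changes E hE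
  have hB : ∀ x : {x // Portal x}, ∃ B, (dec B).depth = D x ∧ ∀ j ≤ J, (dec B).level j =
      (id (f j x), ⟨T.dist x (f j x), by simpa using hT.dist_lt_card x.1 (f j x).1⟩) := by
    intro x
    refine hdec _ (fun j => (id (f j x),
      ⟨T.dist x (f j x), by simpa using hT.dist_lt_card x.1 (f j x).1⟩)) ?_
    have hpow := h3 J x
    have hcard : Nat.card {x // Portal x} ≤ n := by
      simpa using Nat.card_le_card_of_injective (Subtype.val : {x // Portal x} → Fin n)
        Subtype.val_injective
    refine le_trans (Finset.card_le_card ?_)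
      (Nat.le_log_of_pow_le (by norm_num) (hpow.trans hcard))
    intro j hj
    rw [Finset.mem_filter] at hj ⊢
    exact ⟨hj.1, fun he => hj.2 (by simp only [he])⟩
  choose B hB using hB
  refine ⟨fun x => if h : Portal x then B ⟨x, h⟩ else fun _ _ => false,
    fun j x => if h : Portal x then f j ⟨x, h⟩ else x, fun x hx => ?_⟩
  simp only [dif_pos hx]
  refine ⟨(hB _).1, fun j hj => ⟨(f j ⟨x, hx⟩).2, h1 j ⟨x, hx⟩, fun y hy hxy => ?_, ?_, ?_⟩⟩
  · rw [dif_pos hy, h2 j ⟨x, hx⟩ ⟨y, hy⟩ hxy]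
  · rw [(hB _).2 j hj]
  · rw [(hB _).2 j hj]

theorem Rooting.neighborsOK (R : Rooting T) {s : ℕ}
    {l : Fin n → List Bool} (hcol : ∀ u, (c.record l u).lab.color = (R.dep u : ZMod 3))
    (hmark : ∀ u, (c.record l u).lab.isMarked = true ↔ R.IsMarked s u)
    (hroot : ∀ u, (c.record l u).lab.isRoot = true ↔ R.dep u = 0)
    {u v₁ v₂ : Fin n} (h₁ : T.Adj u v₁) (h₂ : T.Adj u v₂) :
    NeighborsOK (c.record l u) (c.record l v₁) (c.record l v₂) := by
  have hz : ∀ z : ZMod 3, z + 1 ≠ z ∧ z ≠ z + 1 ∧ z + 1 ≠ z - 1 ∧ z ≠ z + 1 + 1 := by decide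
  have hup : ∀ v, T.Adj u v → (R.dep v : ZMod 3) = R.dep u - 1 → R.dep v + 1 = R.dep u ∧
      R.par u = v := by
    intro v hv hc
    rcases R.eq_par u v hv with he | he
    · exact he
    · rw [← he.1] at hc
      push_cast at hc
      exact absurd hc (hz _).2.2.1
  have hdn : ∀ v, T.Adj u v → (R.dep v : ZMod 3) = R.dep u + 1 → R.dep u + 1 = R.dep v ∧
      R.par v = u := by
    intro v hv hc
    rcases R.eq_par u v hv with he | he
    · rw [← he.1] at hc
      push_cast at hc
      exact absurd hc (hz _).2.2.2
    · exact he
  simp only [NeighborsOK, hcol, hmark, hroot]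
  refine ⟨?_, ?_, ?_, ?_⟩
  · intro he
    rcases R.eq_par u v₁ h₁ with h' | h' <;> rw [← h'.1] at he <;> push_cast at he
    · exact (hz _).2.1 he
    · exact (hz _).1 he
  · intro h0 he
    have := (hup v₁ h₁ he).1
    omega
  · intro e1 e2
    rw [← (hup v₁ h₁ e1).2, ← (hup v₂ h₂ e2).2]
  · intro m1 m2 e1 e2
    have a1 := hdn v₁ h₁ e1
    have a2 := hdn v₂ h₂ e2
    rw [m1.eq_of_par_eq m2 (by omega) (a1.2.trans a2.2.symm)]

theorem Encodes.stored_of_rooting (h : Encodes d c w T) (R : Rooting T) {a s b t : ℕ}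
    {dec : (Fin s → Fin b → Bool) → PortalLabel a n} {B : Fin n → Fin s → Fin b → Bool}
    {l : Fin n → List Bool} (hcol : ∀ u, (c.record l u).lab.color = (R.dep u : ZMod 3))
    (hport : ∀ u, (c.record l u).lab.isPortal = true ↔ R.IsPortal s u)
    (hmark : ∀ u, (c.record l u).lab.isMarked = true ↔ R.IsMarked s u)
    (hs : 0 < s)
    (hbits : ∀ u, (fun j : Fin b => (c.record l u).lab.bits j) =
      B (R.top s u) ⟨R.dep u % s, Nat.mod_lt _ hs⟩)
    {v x : Fin n} (hx : R.IsPortal s x) (ht : c.graph.dist v x + (s - 1) ≤ t) :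
    Stored (c.view l t v).nodes dec (c.record l x) (dec (B x)) := by
  refine ⟨(hport x).2 hx, fun i => c.record l (R.storage s x i), by simp only [hx.storage_zero],
    fun i hi => c.record_mem_view l ?_, fun i hi => ⟨⟨_, (h.markedStep_iff l).2
      ⟨hx.adj_storage hi, le_rfl⟩⟩, (hmark _).2 (hx.isMarked_storage hi), ?_⟩, ?_⟩
  · have : c.graph.dist x (R.storage s x i) ≤ i := by
      induction i with
      | zero => rw [hx.storage_zero]; simp
      | succ i ih =>
        have h1 := c.connected.dist_triangle (u := x) (v := R.storage s x i)
          (w := R.storage s x (i + 1))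
        have h2 := dist_eq_one_iff_adj.2 (h.2.1 (hx.adj_storage hi))
        have := ih (by omega)
        omega
    have := c.connected.dist_triangle (u := v) (v := x) (w := R.storage s x i)
    omega
  · rw [hcol, hcol, hx.dep_storage hi, hx.dep_storage (by omega)]
    push_cast
    ring
  · congr 1
    funext i
    rw [hbits, hx.top_storage i.2]
    congr 1
    exact Fin.ext (hx.dep_storage_mod i.2)

theorem Encodes.exists_labeling (h : Encodes d c w T) (hmst : IsMST c.graph w T)
    {N a s b t : ℕ} (hN : N = n ^ d) (hs : 0 < s) (ht : 1 + 5 * (s - 1) ≤ t)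
    (ha : ∀ v, c.id v < a) (dec : (Fin s → Fin b → Bool) → PortalLabel a n)
    (hdec : ∀ (D : Fin n) (g : ℕ → Fin a × Fin n),
      ((Finset.range (2 * N)).filter fun j => g (j + 1) ≠ g j).card ≤ Nat.log 2 n →
      ∃ B, (dec B).depth = D ∧ ∀ j ≤ 2 * N, (dec B).level j = g j) :
    ∃ l : Fin n → List Bool, (∀ v, (l v).length = b + 5) ∧
      ∀ v, Accepts N (4 * (s - 1)) dec (c.view l t v).nodes (c.record l v) := by
  classical
  have hT := hmst.1.2
  obtain ⟨r⟩ := c.connected.nonempty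
  obtain ⟨R, hR⟩ := exists_rooting hT r
  have hR0 : R.dep r = 0 := by rw [hR]; simp
  obtain ⟨B, f, hBf⟩ := exists_portalLabels (w := w) (N := (N : ℤ)) hT.connected
    (fun v => ⟨c.id v, ha v⟩)
    (fun x => ⟨R.dep x, by rw [hR]; simpa using hT.connected.dist_lt_card r x⟩) dec hdec
    (R.IsPortal s)
  -- Each node carries the block, indexed by its depth modulo `s`, of the certificate of its segment
  -- top. Off the storage paths these bits are never needed.
  choose l hlen hcol hport hmark hroot hbits using fun u => NodeLabel.exists_decode_eq
    (R.dep u : ZMod 3) (decide (R.IsPortal s u)) (decide (R.IsMarked s u)) (decide (R.dep u = 0))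
    (B (R.top s u) ⟨R.dep u % s, Nat.mod_lt _ hs⟩)
  have hport' : ∀ u, (c.record l u).lab.isPortal = true ↔ R.IsPortal s u := fun u => by
    rw [show (c.record l u).lab.isPortal = _ from hport u, decide_eq_true_iff]
  have hmark' : ∀ u, (c.record l u).lab.isMarked = true ↔ R.IsMarked s u := fun u => by
    rw [show (c.record l u).lab.isMarked = _ from hmark u, decide_eq_true_iff]
  have hroot' : ∀ u, (c.record l u).lab.isRoot = true ↔ R.dep u = 0 := fun u => by
    rw [show (c.record l u).lab.isRoot = _ from hroot u, decide_eq_true_iff]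
  have hstored : ∀ {v x}, R.IsPortal s x → c.graph.dist v x + (s - 1) ≤ t →
      Stored (c.view l t v).nodes dec (c.record l x) (dec (B x)) := fun hx =>
    h.stored_of_rooting R hcol hport' hmark' hs hbits hx
  have hdist : ∀ {β : ℤ} {u v : Fin n} (p : (below T w β).Walk u v),
      c.graph.dist u v ≤ p.length := fun {β u v} p => by
    have := c.graph.dist_le (p.mapLe ((below_le T w β).trans h.2.1))
    rwa [Walk.length_mapLe] at this
  have hTN : T ≤ below T w N := fun x y hxy => by
    refine ⟨hxy, ?_⟩
    have := (abs_le.1 (h.1 s(x, y) (h.2.1 hxy))).2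
    rw [hN]
    exact_mod_cast this
  have hlen_dist : ∀ {β : ℤ} {u v : Fin n} {p : (below T w β).Walk u v}, p.IsPath →
      p.length = T.dist u v := fun {β u v p} hp => by
    have := length_eq_dist_of_isPath hT (hp.mapLe (below_le T w β))
    rwa [Walk.length_mapLe] at this
  have hlev : ∀ {β : ℤ}, -(N : ℤ) ≤ β → β ≤ N →
      levelOf N β ≤ 2 * N ∧ ((levelOf N β : ℕ) : ℤ) - N = β := by
    intro β h1 h2
    unfold levelOf
    omega
  refine ⟨l, hlen, fun v => ⟨?_, ?_, ?_, ?_⟩⟩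
  · intro e₁ he₁ e₂ he₂ t₁ t₂
    obtain ⟨v₁, a₁, i₁, -, m₁⟩ := h.mem_input.1 he₁
    obtain ⟨v₂, a₂, i₂, -, m₂⟩ := h.mem_input.1 he₂
    have d₁ := dist_eq_one_iff_adj.2 a₁
    have d₂ := dist_eq_one_iff_adj.2 a₂
    exact ⟨_, c.record_mem_view l (by omega), _, c.record_mem_view l (by omega), i₁.symm, i₂.symm,
      R.neighborsOK hcol hmark' hroot' (m₁.1 t₁) (m₂.1 t₂)⟩
  · intro e he
    obtain ⟨u, hvu, hi, hw, -⟩ := h.mem_input.1 he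
    have d₁ := dist_eq_one_iff_adj.2 hvu
    refine ⟨_, c.record_mem_view l (u := u) (by omega), hi.symm, ?_⟩
    have habs := abs_le.1 (h.1 s(v, u) hvu)
    obtain ⟨hl1, hl2⟩ := hlev (β := w s(v, u)) (by rw [hN]; exact_mod_cast habs.1)
      (by rw [hN]; exact_mod_cast habs.2)
    have hreach := hmst.reachable_below hvu
    rw [← hw] at hreach hl1 hl2
    obtain ⟨p, hp⟩ := hreach.exists_isPath
    rcases le_total p.length (4 * (s - 1)) with hle | hle
    -- A long path is instead searched for a portal from each end. From `u`, this needs radius 1 for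
    -- the edge, `4 * (s - 1)` to the portal and `s - 1` for its storage path.
    · exact Or.inl (h.reachIn_of_walk l p hle (by rw [dist_self]; omega))
    · right
      obtain ⟨i, -, hi1, hi2⟩ := R.exists_portal_of_isPath hs (below_le T w e.2.1) hp (j := 0)
        (by omega)
      obtain ⟨i', -, hi1', hi2'⟩ := R.exists_portal_of_isPath hs (below_le T w e.2.1) hp.reverse
        (j := 0) (by rw [Walk.length_reverse]; omega)
      have t1 : (p.take i).length ≤ 4 * (s - 1) := by rw [Walk.take_length]; omega
      have t2 : (p.reverse.take i').length ≤ 4 * (s - 1) := by rw [Walk.take_length]; omega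
      have e1 := hdist (p.take i)
      have e2 := hdist (p.reverse.take i')
      have e3 := c.connected.dist_triangle (u := v) (v := u) (w := p.reverse.getVert i')
      refine ⟨_, _, _, _, h.reachIn_of_walk l (p.take i) t1 (by rw [dist_self]; omega),
        h.reachIn_of_walk l (p.reverse.take i') t2 (by omega), hstored hi2 (by omega),
        hstored hi2' (by omega), ?_⟩
      have q1 := (hBf _ hi2).2 _ hl1
      have q2 := (hBf _ hi2').2 _ hl1
      rw [q1.2.2.2.1, q2.2.2.2.1, q1.2.2.1 _ hi2']
      rw [hl2]
      exact ((p.take i).reachable.symm.trans hreach).trans (p.reverse.take i').reachable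
  · obtain ⟨p, hp⟩ := ((hT.connected v r).mono hTN).exists_isPath
    rcases le_total p.length (4 * (s - 1)) with hle | hle
    · exact ⟨_, h.reachIn_of_walk l p hle (by rw [dist_self]; omega), Or.inl ((hroot' r).2 hR0)⟩
    · obtain ⟨i, -, hi1, hi2⟩ := R.exists_portal_of_isPath hs (below_le T w N) hp (j := 0)
        (by omega)
      have t1 : (p.take i).length ≤ 4 * (s - 1) := by rw [Walk.take_length]; omega
      have e1 := hdist (p.take i)
      exact ⟨_, h.reachIn_of_walk l (p.take i) t1 (by rw [dist_self]; omega),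
        Or.inr ⟨_, hstored hi2 (by omega)⟩⟩
  · intro hv
    rw [hport'] at hv
    refine ⟨_, hstored hv (by rw [dist_self]; omega), ?_, ?_⟩
    · obtain ⟨p, hp⟩ := ((hT.connected v r).mono hTN).exists_isPath
      rcases le_total p.length (4 * (s - 1) + 1) with hle | hle
      · exact ⟨_, h.reachIn_of_walk l p hle (by rw [dist_self]; omega), Or.inl ((hroot' r).2 hR0)⟩
      -- The search starts at index 1 because `v` is itself a portal and strict progress is
      -- required; hence the bound `K + 1` in the check.
      · obtain ⟨i, hi0, hi1, hi2⟩ := R.exists_portal_of_isPath hs (below_le T w N) hp (j := 1)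
          (by omega)
        have t1 : (p.take i).length ≤ 4 * (s - 1) + 1 := by rw [Walk.take_length]; omega
        have e1 := hdist (p.take i)
        refine ⟨_, h.reachIn_of_walk l (p.take i) t1 (by rw [dist_self]; omega),
          Or.inr ⟨_, hstored hi2 (by omega), ?_⟩⟩
        rw [(hBf _ hi2).1, (hBf _ hv).1, Fin.mk_lt_mk, hR, hR, T.dist_comm, T.dist_comm (u := r),
          ← hlen_dist hp, ← hlen_dist (hp.drop i), Walk.drop_length]
        omega
    · intro β hβ1 hβ2
      obtain ⟨hl1, hl2⟩ := hlev hβ1 hβ2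
      obtain ⟨q1, q2, q3, q4, q5⟩ := (hBf _ hv).2 _ hl1
      rw [hl2] at q2 q3
      set z := f (levelOf N β) v with hz
      by_cases hzv : z = v
      · left
        rw [q4, hzv]
        rfl
      right
      obtain ⟨p, hp⟩ := q2.exists_isPath
      rcases le_total p.length (4 * (s - 1) + 1) with hle | hle
      -- The representative is within reach; it represents itself, at distance 0.
      · have e1 := hdist p
        refine ⟨_, _, h.reachIn_of_walk l p hle (by rw [dist_self]; omega),
          hstored q1 (by omega), ?_, ?_⟩
        · rw [((hBf _ q1).2 _ hl1).2.2.2.1, q4, ← q3 z q1 q2]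
        · rw [Fin.lt_def, ((hBf _ q1).2 _ hl1).2.2.2.2, q5, ← q3 z q1 q2, dist_self]
          exact hT.connected.pos_dist_of_ne (Ne.symm hzv)
      · obtain ⟨i, hi0, hi1, hi2⟩ := R.exists_portal_of_isPath hs (below_le T w β) hp (j := 1)
          (by omega)
        have t1 : (p.take i).length ≤ 4 * (s - 1) + 1 := by rw [Walk.take_length]; omega
        have e1 := hdist (p.take i)
        have e2 := q3 _ hi2 (p.take i).reachable
        refine ⟨_, _, h.reachIn_of_walk l (p.take i) t1 (by rw [dist_self]; omega),
          hstored hi2 (by omega), ?_, ?_⟩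
        · rw [((hBf _ hi2).2 _ hl1).2.2.2.1, q4, ← e2]
        · rw [Fin.lt_def, ((hBf _ hi2).2 _ hl1).2.2.2.2, q5, ← e2, ← hlen_dist hp,
            ← hlen_dist (hp.drop i), Walk.drop_length]
          omega

end Completeness

/-! ### Bit counts and assembly of the scheme -/

theorem portalLabel_card_le (k d n : ℕ) (hn : 2 ≤ n) :
    n * ((n ^ k + 1) * n) * ((2 * n ^ d + 2) * ((n ^ k + 1) * n)) ^ Nat.log 2 n ≤
      2 ^ (4 * (d + 2 * k + 7) * Nat.log 2 n ^ 2) := by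
  set L := Nat.log 2 n with hL
  have hL1 : 1 ≤ L := Nat.log_pos (by norm_num) hn
  have hlt : n ≤ 2 ^ (L + 1) := (Nat.lt_pow_succ_log_self (by norm_num) n).le
  have hpow : ∀ m, n ^ m ≤ 2 ^ ((L + 1) * m) := fun m => by
    rw [pow_mul]; exact Nat.pow_le_pow_left hlt m
  have hone : ∀ m, 1 ≤ 2 ^ m := fun m => Nat.one_le_two_pow
  have ha : n ^ k + 1 ≤ 2 ^ ((L + 1) * k + 1) := by
    have := hpow k
    have := hone ((L + 1) * k)
    rw [pow_succ]; omega
  have hN : 2 * n ^ d + 2 ≤ 2 ^ ((L + 1) * d + 2) := by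
    have := hpow d
    have := hone ((L + 1) * d)
    rw [pow_add]; omega
  calc n * ((n ^ k + 1) * n) * ((2 * n ^ d + 2) * ((n ^ k + 1) * n)) ^ L
      ≤ 2 ^ (L + 1) * (2 ^ ((L + 1) * k + 1) * 2 ^ (L + 1)) *
        (2 ^ ((L + 1) * d + 2) * (2 ^ ((L + 1) * k + 1) * 2 ^ (L + 1))) ^ L := by gcongr
    _ = 2 ^ ((L + 1) + ((L + 1) * k + 1 + (L + 1)) +
        ((L + 1) * d + 2 + ((L + 1) * k + 1 + (L + 1))) * L) := by
      simp only [← pow_add, ← pow_mul]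
    _ ≤ 2 ^ (4 * (d + 2 * k + 7) * L ^ 2) := by
      apply Nat.pow_le_pow_right (by norm_num)
      obtain ⟨m, hm⟩ : ∃ m, L = m + 1 := ⟨L - 1, by omega⟩
      rw [hm]
      ring_nf
      nlinarith [Nat.zero_le (m * k), Nat.zero_le (m * d), Nat.zero_le (m ^ 2 * k),
        Nat.zero_le (m ^ 2 * d), Nat.zero_le (m ^ 2)]

/-- The `s = (t - 1) / 5 + 1` blocks have enough room since `t ≤ 5 * s`; bounding the squared
logarithm by its cube is pure slack. -/
theorem log_sq_le_mul (c n t : ℕ) (hn : 2 ≤ n) (ht : 1 ≤ t) :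
    c * Nat.log 2 n ^ 2 ≤ ((t - 1) / 5 + 1) * (5 * c * ⌈Real.logb 2 n ^ 3 / t⌉₊) := by
  set q := ⌈Real.logb 2 n ^ 3 / t⌉₊ with hq
  have hs : t ≤ 5 * ((t - 1) / 5 + 1) := by omega
  have ht0 : (0 : ℝ) < t := by exact_mod_cast ht
  have h1 : Real.logb 2 n ^ 3 ≤ q * t := by
    rw [← div_le_iff₀ ht0]; exact Nat.le_ceil _
  have h2 : (Nat.log 2 n : ℝ) ≤ Real.logb 2 n := by
    exact_mod_cast Real.natLog_le_logb n 2
  have h3 : Nat.log 2 n ^ 3 ≤ q * t := by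
    have : (Nat.log 2 n : ℝ) ^ 3 ≤ q * t :=
      (pow_le_pow_left₀ (by positivity) h2 3).trans h1
    exact_mod_cast this
  have h4 : Nat.log 2 n ^ 2 ≤ Nat.log 2 n ^ 3 :=
    Nat.pow_le_pow_right (Nat.log_pos (by norm_num) hn) (by norm_num)
  calc c * Nat.log 2 n ^ 2 ≤ c * (q * (5 * ((t - 1) / 5 + 1))) := by
        gcongr
        exact (h4.trans h3).trans (Nat.mul_le_mul_left q hs)
    _ = _ := by ring

/-- A view contains the number of nodes, so verifiers chosen separately for each `n` combine into
one. -/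
theorem exists_pls {Input : Type} {k : ℕ} {F P : ∀ n, Set (Config Input k n)} {t B : ℕ → ℕ}
    (h : ∀ n, ∃ A : View Input → Prop,
      (∀ c ∈ P n, ∃ l : Fin n → List Bool, (∀ v, (l v).length ≤ B n) ∧
        ∀ v, A (c.view l (t n) v)) ∧
      ∀ c ∈ F n, ∀ l, (∀ v, A (c.view l (t n) v)) → c ∈ P n) :
    ∃ S : PLS F P t, ∀ n, S.cost n ≤ B n := by
  classical
  choose A hc hs using h
  choose l hl ha using hc
  refine ⟨⟨fun {n} c => if h : c ∈ P n then l n c h else fun _ => [],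
    fun x => decide (A x.size x), ?_, ?_⟩, ?_⟩
  · intro n c hcP v
    simp only [dif_pos hcP, decide_eq_true_iff]
    exact ha n c hcP v
  · intro n c hcF l' hacc
    exact hs n c hcF l' fun v => of_decide_eq_true (hacc v)
  · intro n
    refine iSup₂_le fun c hcP => iSup_le fun v => ?_
    simp only [dif_pos hcP]
    exact_mod_cast hl n c hcP v

/-- The verifier on graphs with `n ≥ 2` nodes. -/
theorem exists_verifier (k d n t : ℕ) (hn : 2 ≤ n) (ht : 1 ≤ t) :
    ∃ A : View MSTInput → Prop,
      (∀ c ∈ mstPredicate k d n, ∃ l : Fin n → List Bool,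
        (∀ v, (l v).length ≤ 20 * (d + 2 * k + 7) * ⌈Real.logb 2 n ^ 3 / t⌉₊ + 5) ∧
        ∀ v, A (c.view l t v)) ∧
      ∀ c ∈ mstFamily k d n, ∀ l, (∀ v, A (c.view l t v)) → c ∈ mstPredicate k d n := by
  -- The spacing `(t - 1) / 5 + 1` is the largest `s` with `1 + 5 * (s - 1) ≤ t`.
  obtain ⟨dec, hdec⟩ := exists_portalDecoder (n ^ k + 1) n (2 * n ^ d) (Nat.log 2 n)
    ((t - 1) / 5 + 1) (5 * (4 * (d + 2 * k + 7)) * ⌈Real.logb 2 n ^ 3 / t⌉₊) (by omega) (by omega)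
    ((portalLabel_card_le k d n hn).trans
      (Nat.pow_le_pow_right (by norm_num) (log_sq_le_mul _ n t hn ht)))
  refine ⟨fun x => ∃ y ∈ x.nodes, y.1 = x.center ∧
    Accepts (n ^ d : ℕ) (4 * ((t - 1) / 5 + 1 - 1)) dec x.nodes y, ?_, ?_⟩
  · rintro c ⟨w, T, hE, hmst⟩
    obtain ⟨l, hlen, hacc⟩ := hE.exists_labeling hmst rfl (by omega) (t := t) (by omega)
      (fun v => Nat.lt_succ_of_le (c.id_le v)) dec hdec
    refine ⟨l, fun v => ?_, fun v => ⟨_, c.record_mem_view l (u := v) (by simp), rfl, hacc v⟩⟩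
    exact le_of_eq (by rw [hlen]; ring)
  · rintro c ⟨w, T, hE⟩ l hacc
    refine ⟨w, T, hE, hE.isMST_of_accepts (l := l) (A := fun v => (c.view l t v).nodes)
      (N := ((n ^ d : ℕ) : ℤ)) (K := 4 * ((t - 1) / 5 + 1 - 1)) (dec := dec) (by push_cast; rfl)
      ?_ ?_⟩
    · rintro v x ⟨u, -, rfl⟩
      exact ⟨u, rfl⟩
    · intro v
      obtain ⟨y, ⟨u, hu, rfl⟩, hid, hy⟩ := hacc v
      obtain rfl : u = v := c.id_injective hid
      exact hy

theorem mstFamily_subset_of_le_one {k d n : ℕ} (hn : n ≤ 1) :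
    mstFamily k d n ⊆ mstPredicate k d n := by
  rintro c ⟨w, T, hE⟩
  have := c.connected.nonempty
  have : Subsingleton (Fin n) := Fin.subsingleton_iff_le_one.2 hn
  refine ⟨w, T, hE, ⟨hE.2.1, SimpleGraph.IsTree.of_subsingleton⟩, fun T' _ => ?_⟩
  rw [Subsingleton.elim T T']

end ProofLabeling

theorem mainTheorem4 (k d : ℕ) :
    ∃ C : ℕ, ∀ t : ℕ → ℕ, (∀ n, 1 ≤ n → 1 ≤ t n ∧ Real.logb 2 n ≤ t n) →
      ∃ S : ProofLabeling.PLS (ProofLabeling.mstFamily k d) (ProofLabeling.mstPredicate k d) t,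
        ∀ n, 1 ≤ n → S.cost n ≤ ((C * ⌈Real.logb 2 n ^ 3 / t n⌉₊ : ℕ) : ℕ∞) := by
  refine ⟨20 * (d + 2 * k + 7) + 5, fun t ht => ?_⟩
  obtain ⟨S, hS⟩ := ProofLabeling.exists_pls (t := t) (F := ProofLabeling.mstFamily k d)
    (P := ProofLabeling.mstPredicate k d)
    (B := fun n => (20 * (d + 2 * k + 7) + 5) * ⌈Real.logb 2 n ^ 3 / t n⌉₊) (fun n => by
      rcases Nat.lt_or_ge n 2 with hn | hn
      -- For `n = 1` the bound is 0, so the labels must be empty.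
      · exact ⟨fun _ => True, fun c _ => ⟨fun _ => [], by simp, by simp⟩,
          fun c hc _ _ => ProofLabeling.mstFamily_subset_of_le_one (by omega) hc⟩
      · have ht1 := (ht n (by omega)).1
        obtain ⟨A, h1, h2⟩ := ProofLabeling.exists_verifier k d n (t n) hn ht1
        refine ⟨A, fun c hc => ?_, h2⟩
        obtain ⟨l, hl, hA⟩ := h1 c hc
        refine ⟨l, fun v => (hl v).trans ?_, hA⟩
        -- This absorbs the 5 bits for color and flags into the constant.
        have hq : 1 ≤ ⌈Real.logb 2 n ^ 3 / t n⌉₊ := by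
          rw [Nat.one_le_ceil_iff]
          have h0 : 0 < Real.logb 2 n := Real.logb_pos (by norm_num) (by exact_mod_cast hn)
          have h1 : (0 : ℝ) < t n := by exact_mod_cast ht1
          positivity
        rw [add_mul]
        omega)
  exact ⟨S, fun n _ => hS n⟩
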